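/- Let $G^3(n,p)$ denote the random $3$-uniform hypergraph on the vertex set $[n]$ in which each of the $\binom n3$ triples is an edge independently with probability $p$. Let $F_5$ be the $3$-uniform hypergraph with vertices $a,b,c,d,e$ and edges $abc, ade, bde$, and let $K_4^-$ be the $3$-uniform hypergraph with $4$ vertices and $3$ edges. A hypergraph is $F_5$-free if it contains no copy of $F_5$ as a (not necessarily induced) subhypergraph; a maximum $F_5$-free subhypergraph of $G$ is an $F_5$-free subhypergraph of $G$ with the largest possible number of edges. A $3$-uniform hypergraph is tripartite if its vertex set can be partitioned into three (possibly empty) parts such that every edge has exactly one vertex in each part. An event holds with high probability (w.h.p.) if its probability tends to $1$ as $n\to\infty$. Let $p = p(n) = 0.1\sqrt{\log n}/n$, where $\log$ is the natural logarithm. Then: 1. w.h.p. $G^3(n,p)$ contains a copy of $K_4^-$ none of whose edges lies in a copy of $F_5$ in $G^3(n,p)$; 2. w.h.p. there is a maximum $F_5$-free subhypergraph of $G^3(n,p)$ that is not tripartite. -/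

import Mathlib

open MeasureTheory Filter Topology

/-- A hypergraph on the vertex set `V`, given by its set of hyperedges. -/
abbrev HGraph (V : Type*) := Set (Finset V)

namespace HGraph

/-- `F₅`, with `a, b, c, d, e = 0, 1, 2, 3, 4` and edges `abc, ade, bde`. -/
def F5 : HGraph (Fin 5) := {{0, 1, 2}, {0, 3, 4}, {1, 3, 4}}

/-- `K₄⁻`: four vertices and three of the four triples. -/
def K4minus : HGraph (Fin 4) := {{0, 1, 2}, {0, 1, 3}, {0, 2, 3}}

/-- `C` is (the edge set of) a copy of `F` on the vertex set `V`: the image of `F` under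
an injective map of the vertices. -/
def IsCopy {U V : Type*} (F : HGraph U) (C : HGraph V) : Prop :=
  ∃ f : U ↪ V, C = Finset.map f '' F

/-- `H` contains no copy of `F` (as a not necessarily induced subhypergraph). -/
def IsFree {U V : Type*} (F : HGraph U) (H : HGraph V) : Prop :=
  ∀ C : HGraph V, IsCopy F C → ¬ C ⊆ H

/-- `M` is a maximum `F`-free subhypergraph of `H`, with respect to the number of edges. -/
def IsMaximumFreeSub {U V : Type*} (F : HGraph U) (M H : HGraph V) : Prop :=
  (M ⊆ H ∧ IsFree F M) ∧
    ∀ M' : HGraph V, M' ⊆ H → IsFree F M' → M'.encard ≤ M.encard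

/-- The vertices can be partitioned into three (possibly empty) classes such that every edge
has exactly one vertex in each class. -/
def IsTripartite {V : Type*} (H : HGraph V) : Prop :=
  ∃ c : V → Fin 3, ∀ e ∈ H, ∀ i : Fin 3, ∃! x, x ∈ e ∧ c x = i

end HGraph

/-- The law of the random `r`-uniform hypergraph `G^r(n, p)` on `n` labelled vertices: each
`r`-element set of vertices is an edge independently with probability `p`, and no other set
is an edge. -/
noncomputable def randomHGraph (r n : ℕ) (p : unitInterval) : Measure (HGraph (Fin n)) :=
  ProbabilityTheory.setBernoulli {e : Finset (Fin n) | e.card = r} p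

/-- The edge probability `0.1 √(log n) / n` (it is `0` for `n = 0`). -/
noncomputable def edgeProb (n : ℕ) : unitInterval :=
  ⟨0.1 * Real.sqrt (Real.log n) / n, by
    rcases Nat.eq_zero_or_pos n with rfl | hn
    · simp
    · have h1 : (1 : ℝ) ≤ n := by exact_mod_cast hn
      have h2 : Real.sqrt (Real.log n) ≤ n := by
        rw [Real.sqrt_le_left (by linarith)]
        have := Real.log_le_sub_one_of_pos (show (0 : ℝ) < n by linarith)
        nlinarith
      refine ⟨by positivity, ?_⟩
      rw [div_le_one (by linarith)]
      have := Real.sqrt_nonneg (Real.log n)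
      linarith⟩

/-- The sequence of events `A n` holds with high probability under the laws `P n`. -/
def Whp {Ω : ℕ → Type*} [∀ n, MeasurableSpace (Ω n)] (P : ∀ n, Measure (Ω n))
    (A : ∀ n, Ω n → Prop) : Prop :=
  Tendsto (fun n => P n {ω | A n ω}) atTop (𝓝 1)

/-! ### Independence and the second moment method for Bernoulli random sets -/

namespace ProbabilityTheory

variable {ι : Type*}

/-! Call a copy of `K₄⁻` on a 4-set `S` isolated if no edge of `G` has exactly two vertices in `S`,
and no two edges `xzw`, `yzw` have distinct `x, y` in `S` and `z, w` outside `S`. An `F₅` using an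
edge of the copy would have to leave `S`, having five vertices, and would then violate one of these
conditions (`isolated_notMem_F5`). So one isolated copy gives the first claim. Its edges also lie in
every maximum `F₅`-free subhypergraph, and `K₄⁻` is not tripartite, which gives the second.

Isolated copies exist by the second moment method. Isolation costs a factor of at least `exp(-12np -
12(np)²)` (`le_measure_isolated`). Since `(np)² = 0.01 log n`, this is at least `n^(-1/4)` for large
`n`, and the expected number of isolated copies is at least of order `n^4 p^3 n^(-1/4)`, which tends
to infinity. For the variance (`measure_isolated_inter_le`), vertex-disjoint copies are almost
independent. Copies on different vertex sets that share an edge are never both isolated. The other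
pairs with a common vertex contribute at most `O(n^7 p^6)` in total if their edge sets are disjoint,
or a constant times the mean if their vertex sets coincide. -/

lemma iIndepFun_mem_setBernoulli (u : Set ι) (p : unitInterval) :
    iIndepFun (fun (e : ι) (G : Set ι) => e ∈ G) (setBernoulli u p) := by
  have h : ∀ (S : Finset ι) (s : ι → Set Prop),
      setBernoulli u p (⋂ i ∈ S, (fun G : Set ι => i ∈ G) ⁻¹' s i) =
        ∏ i ∈ S, (unitInterval.toNNReal p • Measure.dirac (i ∈ u) +
          unitInterval.toNNReal (unitInterval.symm p) • Measure.dirac False) (s i) := by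
    intro S s
    rw [setBernoulli_apply', ← Measure.infinitePi_pi _ (fun _ _ => .of_discrete)]
    congr 1
    ext G
    simp [Set.mem_pi]
  rw [iIndepFun_iff_measure_inter_preimage_eq_mul]
  intro S s _
  rw [h]
  refine Finset.prod_congr rfl fun i _ => ?_
  simpa using (h {i} s).symm

lemma setBernoulli_superset {u : Set ι} (p : unitInterval) {S : Finset ι} (hS : ↑S ⊆ u) :
    (setBernoulli u p).real {G | ↑S ⊆ G} = (p : ℝ) ^ S.card := by
  have h : setBernoulli u p {G | ↑S ⊆ G} =
      ∏ i ∈ S, (unitInterval.toNNReal p • Measure.dirac (i ∈ u) +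
          unitInterval.toNNReal (unitInterval.symm p) • Measure.dirac False) {True} := by
    rw [setBernoulli_apply', ← Measure.infinitePi_pi _ (fun _ _ => .of_discrete)]
    congr 1
    ext G
    simp [Set.mem_pi, Set.subset_def]
  rw [measureReal_def, h, Finset.prod_congr rfl (g := fun _ => (unitInterval.toNNReal p : ENNReal))]
  · simp
  · intro i hi
    have : i ∈ u := hS hi
    simp [this]

/-- Whether a set belongs to the family `A` depends only on its trace on `D`. -/
def DeterminedBy (D : Set ι) (A : Set (Set ι)) : Prop :=
  ∀ ⦃G G' : Set ι⦄, (∀ e ∈ D, e ∈ G ↔ e ∈ G') → G ∈ A → G' ∈ A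

lemma DeterminedBy.mono {D D' : Set ι} {A : Set (Set ι)} (h : DeterminedBy D A) (hD : D ⊆ D') :
    DeterminedBy D' A := fun _ _ hG => h fun e he => hG e (hD he)

lemma DeterminedBy.biInter {κ : Type*} {J : Finset κ} {D : κ → Set ι} {A : κ → Set (Set ι)}
    (h : ∀ j ∈ J, DeterminedBy (D j) (A j)) : DeterminedBy (⋃ j ∈ J, D j) (⋂ j ∈ J, A j) := by
  intro G G' hG hA
  simp only [Set.mem_iInter] at hA ⊢
  exact fun j hj => h j hj (fun e he => hG e (Set.mem_biUnion hj he)) (hA j hj)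

variable [Finite ι] {u : Set ι} {p : unitInterval}

/-- A family determined by `D` is a preimage under restriction of the indicator to `D`, and
restrictions to disjoint sets of coordinates are independent. -/
lemma DeterminedBy.measure_inter {D D' : Set ι} {A A' : Set (Set ι)} (h : DeterminedBy D A)
    (h' : DeterminedBy D' A') (hD : Disjoint D D') :
    (setBernoulli u p).real (A ∩ A') =
      (setBernoulli u p).real A * (setBernoulli u p).real A' := by
  classical
  have := Fintype.ofFinite ι
  have key : ∀ {D : Set ι} {A : Set (Set ι)}, DeterminedBy D A → ∃ B : Set (D.toFinset → Prop),
      A = (fun (G : Set ι) (i : D.toFinset) => (i : ι) ∈ G) ⁻¹' B := by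
    intro D A h
    refine ⟨(fun (G : Set ι) (i : D.toFinset) => (i : ι) ∈ G) '' A, ?_⟩
    ext G
    constructor
    · exact fun hG => ⟨G, hG, rfl⟩
    · rintro ⟨G', hG', h'⟩
      refine h (fun e he => ?_) hG'
      have := congrFun h' ⟨e, by simpa using he⟩
      simpa using this
  obtain ⟨B, rfl⟩ := key h
  obtain ⟨B', rfl⟩ := key h'
  have hi := (iIndepFun_mem_setBernoulli u p).indepFun_finset D.toFinset D'.toFinset
    (by simpa using hD) (fun _ => .of_discrete)
  have := hi.measure_inter_preimage_eq_mul B B' .of_discrete .of_discrete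
  simp only [measureReal_def, this, ENNReal.toReal_mul]

lemma DeterminedBy.measure_biInter {κ : Type*} {J : Finset κ} {D : κ → Set ι}
    {A : κ → Set (Set ι)} (h : ∀ j ∈ J, DeterminedBy (D j) (A j))
    (hD : Pairwise fun i j => Disjoint (D i) (D j)) :
    (setBernoulli u p).real (⋂ j ∈ J, A j) = ∏ j ∈ J, (setBernoulli u p).real (A j) := by
  classical
  induction J using Finset.induction_on with
  | empty => simp
  | insert a J ha ih =>
    have hJ : ∀ j ∈ J, DeterminedBy (D j) (A j) := fun j hj => h j (Finset.mem_insert_of_mem hj)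
    rw [Finset.prod_insert ha, ← ih hJ, Finset.set_biInter_insert]
    refine (h a (Finset.mem_insert_self _ _)).measure_inter (.biInter hJ) ?_
    rw [Set.disjoint_iUnion₂_right]
    exact fun j hj => hD (by rintro rfl; exact ha hj)

/-- The second moment bound for the probability that none of the events `A i` occurs. -/
lemma measure_compl_iUnion_le {Ω κ : Type*} [MeasurableSpace Ω] (μ : Measure Ω)
    [IsProbabilityMeasure μ] (I : Finset κ) {A : κ → Set Ω} (hA : ∀ i, MeasurableSet (A i))
    (hY : 0 < ∑ i ∈ I, μ.real (A i)) :
    μ.real (⋃ i ∈ I, A i)ᶜ ≤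
      (∑ i ∈ I, ∑ j ∈ I, μ.real (A i ∩ A j)) / (∑ i ∈ I, μ.real (A i)) ^ 2 - 1 := by
  set Y := ∑ i ∈ I, μ.real (A i) with hYdef
  set X : Ω → ℝ := fun ω => ∑ i ∈ I, (A i).indicator 1 ω with hX
  have hi : ∀ i, Integrable ((A i).indicator (1 : Ω → ℝ)) μ := fun i =>
    (integrable_const 1).indicator (hA i)
  have hXi : Integrable X μ := integrable_finsetSum _ fun i _ => hi i
  have hXint : ∫ ω, X ω ∂μ = Y := by
    rw [hX, integral_finsetSum _ fun i _ => hi i]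
    exact Finset.sum_congr rfl fun i _ => integral_indicator_one (hA i)
  have hX2 : (fun ω => X ω ^ 2) = fun ω => ∑ i ∈ I, ∑ j ∈ I, (A i ∩ A j).indicator 1 ω := by
    funext ω
    simp only [hX, sq, Finset.sum_mul_sum, Set.inter_indicator_one, Pi.mul_apply]
  have hi2 : ∀ i j, Integrable ((A i ∩ A j).indicator (1 : Ω → ℝ)) μ := fun i j =>
    (integrable_const 1).indicator ((hA i).inter (hA j))
  have hX2i : Integrable (fun ω => X ω ^ 2) μ := by
    rw [hX2]
    exact integrable_finsetSum _ fun i _ => integrable_finsetSum _ fun j _ => hi2 i j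
  have hX2int : ∫ ω, X ω ^ 2 ∂μ = ∑ i ∈ I, ∑ j ∈ I, μ.real (A i ∩ A j) := by
    rw [hX2, integral_finsetSum _ fun i _ => integrable_finsetSum _ fun j _ => hi2 i j]
    refine Finset.sum_congr rfl fun i _ => ?_
    rw [integral_finsetSum _ fun j _ => hi2 i j]
    exact Finset.sum_congr rfl fun j _ => integral_indicator_one ((hA i).inter (hA j))
  have hB : MeasurableSet (⋃ i ∈ I, A i)ᶜ := (I.measurableSet_biUnion fun i _ => hA i).compl
  -- Chebyshev's argument: where no event occurs the count `X` is `0`, so `Y²` times the indicator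
  -- is at most `(X - Y)²` pointwise.
  have hle : ∫ ω, (⋃ i ∈ I, A i)ᶜ.indicator (fun _ => Y ^ 2) ω ∂μ ≤
      ∫ ω, (X ω ^ 2 - 2 * Y * X ω + Y ^ 2) ∂μ := by
    refine integral_mono ((integrable_const _).indicator hB)
      ((hX2i.sub (hXi.const_mul _)).add (integrable_const _)) fun ω => ?_
    by_cases hω : ω ∈ (⋃ i ∈ I, A i)ᶜ
    · have : X ω = 0 := by
        refine Finset.sum_eq_zero fun i hi => Set.indicator_of_notMem (fun h => hω ?_) _
        exact Set.mem_biUnion hi h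
      rw [Set.indicator_of_mem hω]
      simp [this]
    · rw [Set.indicator_of_notMem hω]
      nlinarith [sq_nonneg (X ω - Y)]
  have hint : ∫ ω, (X ω ^ 2 - 2 * Y * X ω + Y ^ 2) ∂μ =
      ∑ i ∈ I, ∑ j ∈ I, μ.real (A i ∩ A j) - 2 * Y * Y + Y ^ 2 := by
    rw [integral_add (f := fun ω => X ω ^ 2 - 2 * Y * X ω) (hX2i.sub (hXi.const_mul _))
      (integrable_const _), integral_sub hX2i (hXi.const_mul _), integral_const_mul, hXint, hX2int]
    simp
  rw [integral_indicator_const _ hB, hint, smul_eq_mul] at hle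
  rw [le_sub_iff_add_le, le_div_iff₀ (by positivity)]
  nlinarith

end ProbabilityTheory

/-! ### Copies of `K₄⁻` and maximum `F₅`-free subhypergraphs -/

namespace HGraph

/-- The edges of `K₄⁻`, as a finite set. -/
def K4edges : Finset (Finset (Fin 4)) := {{0, 1, 2}, {0, 1, 3}, {0, 2, 3}}

lemma coe_K4edges : (K4edges : HGraph (Fin 4)) = K4minus := by
  simp [K4edges, K4minus]

/-- Every two of the four vertices of `K₄⁻` lie in a common edge, so a tripartition would need four
distinct classes. -/
lemma not_isTripartite_of_K4minus {V : Type*} {K M : HGraph V} (hK : IsCopy K4minus K)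
    (hKM : K ⊆ M) : ¬ IsTripartite M := by
  rintro ⟨c, hc⟩
  obtain ⟨f, rfl⟩ := hK
  have hne : ∀ e ∈ K4minus, ∀ i ∈ e, ∀ j ∈ e, i ≠ j → c (f i) ≠ c (f j) := by
    intro e he i hi j hj hij h
    obtain ⟨x, -, hx⟩ := hc _ (hKM ⟨e, he, rfl⟩) (c (f i))
    exact hij (f.injective ((hx _ ⟨Finset.mem_map_of_mem f hi, rfl⟩).trans
      (hx _ ⟨Finset.mem_map_of_mem f hj, h.symm⟩).symm))
  have h01 := hne {0, 1, 2} (by simp [K4minus]) 0 (by simp) 1 (by simp) (by simp)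
  have h02 := hne {0, 1, 2} (by simp [K4minus]) 0 (by simp) 2 (by simp) (by simp)
  have h12 := hne {0, 1, 2} (by simp [K4minus]) 1 (by simp) 2 (by simp) (by simp)
  have h03 := hne {0, 1, 3} (by simp [K4minus]) 0 (by simp) 3 (by simp) (by simp)
  have h13 := hne {0, 1, 3} (by simp [K4minus]) 1 (by simp) 3 (by simp) (by simp)
  have h23 := hne {0, 2, 3} (by simp [K4minus]) 2 (by simp) 3 (by simp) (by simp)
  generalize c (f 0) = a at *
  generalize c (f 1) = b at *
  generalize c (f 2) = d at *
  generalize c (f 3) = e at *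
  omega

lemma exists_isMaximumFreeSub {U V : Type*} [Finite V] {F : HGraph U} (hF : F.Nonempty)
    (H : HGraph V) : ∃ M, IsMaximumFreeSub F M H := by
  obtain ⟨M, hM, hmax⟩ := (Set.toFinite {M : HGraph V | M ⊆ H ∧ IsFree F M}).exists_maximalFor
    Set.encard _ ⟨∅, Set.empty_subset _, by
      rintro C ⟨f, rfl⟩ hC
      obtain ⟨e, he⟩ := hF
      exact hC ⟨e, he, rfl⟩⟩
  exact ⟨M, hM, fun M' h h' => (le_total _ _).elim id (hmax ⟨h, h'⟩)⟩

/-- Adding to `M` an edge that lies in no copy of `F` in `H` creates no copy of `F`, so a maximum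
`M` already has it. -/
lemma IsMaximumFreeSub.mem_of_forall_notMem {U V : Type*} [Finite V] {F : HGraph U}
    {M H : HGraph V} (hM : IsMaximumFreeSub F M H) {e : Finset V} (he : e ∈ H)
    (h : ∀ C, IsCopy F C → C ⊆ H → e ∉ C) : e ∈ M := by
  by_contra hn
  have := hM.2 (insert e M) (Set.insert_subset he hM.1.1) fun C hC hCM =>
    hM.1.2 C hC ((Set.subset_insert_iff_of_notMem
      (h C hC (hCM.trans (Set.insert_subset he hM.1.1)))).1 hCM)
  rw [Set.encard_insert_of_notMem hn, ENat.add_one_le_iff (Set.toFinite M).encard_lt_top.ne] at this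
  exact this.false

lemma exists_max_not_isTripartite {V : Type*} [Finite V] {K G : HGraph V}
    (hK : IsCopy K4minus K) (hKG : K ⊆ G)
    (h : ∀ e ∈ K, ∀ C : HGraph V, IsCopy F5 C → C ⊆ G → e ∉ C) :
    ∃ M : HGraph V, IsMaximumFreeSub F5 M G ∧ ¬ IsTripartite M := by
  obtain ⟨M, hM⟩ := exists_isMaximumFreeSub (F := F5) ⟨_, Or.inl rfl⟩ G
  exact ⟨M, hM, not_isTripartite_of_K4minus hK fun e he =>
    hM.mem_of_forall_notMem (hKG he) (h e he)⟩

/-! ### Isolated copies of `K₄⁻` -/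

variable {V : Type*}

/-- The edges of the copy of `K₄⁻` on the range of `f`. -/
def copyK4 (f : Fin 4 ↪ V) : Finset (Finset V) := K4edges.map (Finset.mapEmbedding f).toEmbedding

/-- The vertices of the copy of `K₄⁻` on the range of `f`. -/
def verts (f : Fin 4 ↪ V) : Finset V := Finset.univ.map f

lemma card_verts (f : Fin 4 ↪ V) : (verts f).card = 4 := by simp [verts]

lemma card_copyK4 (f : Fin 4 ↪ V) : (copyK4 f).card = 3 := by
  rw [copyK4, Finset.card_map]; decide

lemma mem_copyK4 {f : Fin 4 ↪ V} {e : Finset V} :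
    e ∈ copyK4 f ↔ ∃ a ∈ K4edges, a.map f = e := by
  simp [copyK4]

lemma card_of_mem_copyK4 {f : Fin 4 ↪ V} {e : Finset V} (he : e ∈ copyK4 f) : e.card = 3 := by
  obtain ⟨a, ha, rfl⟩ := mem_copyK4.1 he
  have h : ∀ a ∈ K4edges, a.card = 3 := by decide
  rw [Finset.card_map, h a ha]

lemma subset_verts_of_mem_copyK4 {f : Fin 4 ↪ V} {e : Finset V} (he : e ∈ copyK4 f) :
    e ⊆ verts f := by
  obtain ⟨a, ha, rfl⟩ := mem_copyK4.1 he
  exact Finset.map_subset_map.2 (Finset.subset_univ _)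

lemma isCopy_copyK4 (f : Fin 4 ↪ V) : IsCopy K4minus (copyK4 f : HGraph V) := by
  refine ⟨f, ?_⟩
  rw [← coe_K4edges]
  simp [copyK4]
  rfl

variable [Fintype V] [DecidableEq V]

/-- The condition, imposed by the isolation of the copy `copyK4 f`, on the edges `e` of `G` with
`e \ verts f = T`. -/
def localEvent (f : Fin 4 ↪ V) (T : Finset V) : Set (HGraph V) :=
  {G | (T.card = 0 → ↑(copyK4 f) ⊆ G) ∧
    (T.card = 1 → ∀ u ∈ (verts f).powersetCard 2, u ∪ T ∉ G) ∧
    (T.card = 2 → ∀ u ∈ (verts f).powersetCard 2, ∃ a ∈ u, insert a T ∉ G)}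

/-- The hypergraphs that contain `copyK4 f` and satisfy a condition which prevents its edges from
lying in a copy of `F₅`. -/
def isolated (f : Fin 4 ↪ V) : Set (HGraph V) := ⋂ T ∈ (verts f)ᶜ.powerset, localEvent f T

lemma mem_isolated {f : Fin 4 ↪ V} {G : HGraph V} :
    G ∈ isolated f ↔ ∀ T, Disjoint T (verts f) → G ∈ localEvent f T := by
  simp [isolated, Finset.subset_compl_iff_disjoint_right]

lemma copyK4_subset_of_mem_isolated {f : Fin 4 ↪ V} {G : HGraph V} (hG : G ∈ isolated f) :
    ↑(copyK4 f) ⊆ G :=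
  (mem_isolated.1 hG ∅ (by simp)).1 rfl

/-- A triple with two vertices in `verts f` is contained in it. -/
lemma subset_verts_of_mem_isolated {f : Fin 4 ↪ V} {G : HGraph V} (hG : G ∈ isolated f) {x y z : V}
    (hxy : x ≠ y) (hx : x ∈ verts f) (hy : y ∈ verts f) (he : {x, y, z} ∈ G) : z ∈ verts f := by
  by_contra hz
  refine (mem_isolated.1 hG {z} (by simpa)).2.1 rfl {x, y} ?_ ?_
  · rw [Finset.mem_powersetCard]
    exact ⟨by grind, Finset.card_pair hxy⟩
  · have : ({x, y} : Finset V) ∪ {z} = {x, y, z} := by grind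
    rwa [this]

lemma false_of_mem_isolated {f : Fin 4 ↪ V} {G : HGraph V} (hG : G ∈ isolated f) {x y z w : V}
    (hxy : x ≠ y) (hzw : z ≠ w) (hx : x ∈ verts f) (hy : y ∈ verts f)
    (hz : z ∉ verts f) (hw : w ∉ verts f) (h : {x, z, w} ∈ G) (h' : {y, z, w} ∈ G) : False := by
  obtain ⟨a, ha, haG⟩ := (mem_isolated.1 hG {z, w} (by simp [hz, hw])).2.2 (Finset.card_pair hzw)
    {x, y} (by rw [Finset.mem_powersetCard]; exact ⟨by grind, Finset.card_pair hxy⟩)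
  grind

/-- An edge with two vertices in `verts f` lies inside it. If the given edge is `ade` or `bde`, this
pulls in the other of `a, b` and then `c`. If it is `abc`, then `d` and `e` are both inside or both
outside; the latter is excluded by the condition on pairs outside `verts f`. -/
lemma isolated_notMem_F5 {f : Fin 4 ↪ V} {G : HGraph V} (hG : G ∈ isolated f) :
    ∀ e ∈ (copyK4 f : HGraph V), ∀ C : HGraph V, IsCopy F5 C → C ⊆ G → e ∉ C := by
  rintro e he C ⟨g, rfl⟩ hC
  have hV : e ⊆ verts f := subset_verts_of_mem_copyK4 he
  have h1 : {g 0, g 1, g 2} ∈ G := hC ⟨{0, 1, 2}, by simp [F5], by simp⟩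
  have h2 : {g 0, g 3, g 4} ∈ G := hC ⟨{0, 3, 4}, by simp [F5], by simp⟩
  have h3 : {g 1, g 3, g 4} ∈ G := hC ⟨{1, 3, 4}, by simp [F5], by simp⟩
  have hne : ∀ i j, i ≠ j → g i ≠ g j := fun i j h h' => h (g.injective h')
  -- The five vertices of `F₅` do not fit into a 4-set; this is the contradiction aimed at below.
  have hfive : ¬ ∀ i, g i ∈ verts f := fun h => by
    have := Finset.card_le_card (s := Finset.univ.map g) (t := verts f) (by
      intro x hx
      obtain ⟨i, -, rfl⟩ := Finset.mem_map.1 hx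
      exact h i)
    simp [card_verts] at this
  rw [Fin.forall_fin_succ, Fin.forall_fin_succ, Fin.forall_fin_succ, Fin.forall_fin_succ] at hfive
  simp only [Fin.forall_fin_one] at hfive
  have key := fun x y z hxy hx hy he => subset_verts_of_mem_isolated hG (x := x) (y := y) (z := z)
    hxy hx hy he
  rintro ⟨a, ha, rfl⟩
  simp only [F5, Set.mem_insert_iff, Set.mem_singleton_iff] at ha
  have perm : ∀ x y z : V, ({x, z, y} : Finset V) = {x, y, z} := by
    intro x y z; ext; simp only [Finset.mem_insert, Finset.mem_singleton]; tauto
  have perm' : ∀ x y z : V, ({y, z, x} : Finset V) = {x, y, z} := by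
    intro x y z; ext; simp only [Finset.mem_insert, Finset.mem_singleton]; tauto
  obtain rfl | rfl | rfl := ha
  · simp only [Finset.map_insert, Finset.map_singleton, Finset.insert_subset_iff,
      Finset.singleton_subset_iff] at hV
    obtain ⟨m0, m1, m2⟩ := hV
    by_cases m3 : g 3 ∈ verts f
    · exact hfive ⟨m0, m1, m2, m3, key _ _ _ (hne 0 3 (by decide)) m0 m3 h2⟩
    by_cases m4 : g 4 ∈ verts f
    · exact m3 (key _ _ _ (hne 0 4 (by decide)) m0 m4 (by rwa [perm]))
    exact false_of_mem_isolated hG (hne 0 1 (by decide)) (hne 3 4 (by decide)) m0 m1 m3 m4 h2 h3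
  · simp only [Finset.map_insert, Finset.map_singleton, Finset.insert_subset_iff,
      Finset.singleton_subset_iff] at hV
    obtain ⟨m0, m3, m4⟩ := hV
    have m1 : g 1 ∈ verts f := key _ _ _ (hne 3 4 (by decide)) m3 m4 (by rwa [perm'])
    exact hfive ⟨m0, m1, key _ _ _ (hne 0 1 (by decide)) m0 m1 h1, m3, m4⟩
  · simp only [Finset.map_insert, Finset.map_singleton, Finset.insert_subset_iff,
      Finset.singleton_subset_iff] at hV
    obtain ⟨m1, m3, m4⟩ := hV
    have m0 : g 0 ∈ verts f := key _ _ _ (hne 3 4 (by decide)) m3 m4 (by rwa [perm'])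
    exact hfive ⟨m0, m1, key _ _ _ (hne 0 1 (by decide)) m0 m1 h1, m3, m4⟩

/-- Two copies of `K₄⁻` on different vertex sets that share at least two vertices are not both
isolated. -/
lemma isolated_inter_eq_empty {f g : Fin 4 ↪ V} (hne : verts g ≠ verts f) {i j : Fin 4}
    (hij : i ≠ j) (hi : g i ∈ verts f) (hj : g j ∈ verts f) : isolated f ∩ isolated g = ∅ := by
  rw [Set.eq_empty_iff_forall_notMem]
  rintro G ⟨hf, hg⟩
  obtain ⟨k, hk⟩ : ∃ k, g k ∉ verts f := by
    by_contra! h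
    refine hne (Finset.eq_of_subset_of_card_le (fun x hx => ?_) (by simp [card_verts]))
    obtain ⟨k, -, rfl⟩ := Finset.mem_map.1 hx
    exact h k
  -- If two or three vertices of `K₄⁻` are marked, some edge has exactly two marked vertices. Here
  -- the marked ones are those sent into `verts f`, and that edge violates the isolation of `f`.
  have comb : ∀ s : Fin 4 → Bool, ∀ i j k : Fin 4, i ≠ j → s i = true → s j = true → s k = false →
      ∃ x y z, x ≠ y ∧ s x = true ∧ s y = true ∧ s z = false ∧ {x, y, z} ∈ K4edges := by
    decide
  obtain ⟨x, y, z, hxy, hx, hy, hz, he⟩ := comb (fun i => decide (g i ∈ verts f)) i j k hij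
    (by simpa) (by simpa) (by simpa)
  simp only [decide_eq_true_eq, decide_eq_false_iff_not] at hx hy hz
  refine hz (subset_verts_of_mem_isolated hf (g.injective.ne hxy) hx hy
    (copyK4_subset_of_mem_isolated hg (mem_copyK4.2 ⟨_, he, ?_⟩)))
  simp

end HGraph

/-! ### The probability of isolation and correlations between copies -/

namespace HGraph

open ProbabilityTheory

variable {V : Type*} (p : unitInterval)

/-- The law of the random `3`-uniform hypergraph on `V`. -/
noncomputable abbrev law (V : Type*) (p : unitInterval) : Measure (HGraph V) :=
  setBernoulli {e : Finset V | e.card = 3} p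

/-- An upper bound for the probability of the complement of `localEvent f T` for `T ≠ ∅`. -/
noncomputable def defect (T : Finset V) : ℝ :=
  if T.card = 1 then 6 * p else if T.card = 2 then 6 * (p : ℝ) ^ 2 else 0

lemma defect_nonneg (T : Finset V) : 0 ≤ defect p T := by
  have := p.2.1
  unfold defect
  split_ifs <;> positivity

lemma defect_le (T : Finset V) : defect p T ≤ 6 * p := by
  have := p.2.1
  have := p.2.2
  unfold defect
  split_ifs <;> nlinarith

lemma measure_localEvent_empty [DecidableEq V] (f : Fin 4 ↪ V) : (law V p).real (localEvent f ∅) = (p : ℝ) ^ 3 := by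
  rw [← card_copyK4 f, ← setBernoulli_superset p (u := {e : Finset V | e.card = 3})
    fun e he => card_of_mem_copyK4 he]
  simp [localEvent]

variable [Fintype V] [DecidableEq V]

/-- The edges that meet `verts f` and agree with `T` outside it. -/
def touching (f : Fin 4 ↪ V) (T : Finset V) : Set (Finset V) :=
  {e | ¬ Disjoint e (verts f) ∧ e \ verts f = T}

lemma determinedBy_localEvent {f : Fin 4 ↪ V} {T : Finset V} (hT : Disjoint T (verts f)) :
    DeterminedBy (touching f T) (localEvent f T) := by
  rintro G G' h ⟨h0, h1, h2⟩
  refine ⟨fun hc e he => ?_, fun hc u hu => ?_, fun hc u hu => ?_⟩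
  · refine (h e ⟨?_, ?_⟩).1 (h0 hc he)
    · intro hd
      have : e = ∅ := Finset.disjoint_self_iff_empty _ |>.1
        (hd.mono_right (subset_verts_of_mem_copyK4 he))
      subst this
      simpa using card_of_mem_copyK4 he
    · rw [Finset.card_eq_zero.1 hc, Finset.sdiff_eq_empty_iff_subset]
      exact subset_verts_of_mem_copyK4 he
  · rw [Finset.mem_powersetCard] at hu
    rw [← h]
    · exact h1 hc u (Finset.mem_powersetCard.2 hu)
    · refine ⟨fun hd => ?_, ?_⟩
      · have : u = ∅ := Finset.disjoint_self_iff_empty _ |>.1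
          ((Finset.disjoint_union_left.1 hd).1.mono_right hu.1)
        simp [this] at hu
      · rw [Finset.union_sdiff_distrib, Finset.sdiff_eq_empty_iff_subset.2 hu.1,
          Finset.empty_union, hT.sdiff_eq_left]
  · obtain ⟨a, ha, haG⟩ := h2 hc u hu
    have hav : a ∈ verts f := (Finset.mem_powersetCard.1 hu).1 ha
    refine ⟨a, ha, ?_⟩
    rwa [← h]
    refine ⟨fun hd => Finset.disjoint_left.1 hd (Finset.mem_insert_self a T) hav, ?_⟩
    rw [Finset.insert_sdiff_of_mem _ hav, hT.sdiff_eq_left]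

/-- Union bound over the six pairs in `verts f`: a pair is bad with probability `p` when `T` is a
single vertex (one forbidden triple) and `p²` when `T` has two (two triples both present). Larger
`T` impose nothing. -/
lemma one_sub_defect_le (f : Fin 4 ↪ V) {T : Finset V} (hT : Disjoint T (verts f)) (h0 : T ≠ ∅) :
    1 - defect p T ≤ (law V p).real (localEvent f T) := by
  have hcard : ((verts f).powersetCard 2).card = 6 := by
    rw [Finset.card_powersetCard, card_verts]; rfl
  have key : ∀ B : Finset V → Set (HGraph V), ∀ c : ℝ,
      (∀ u ∈ (verts f).powersetCard 2, (law V p).real (B u) = c) →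
      (localEvent f T)ᶜ ⊆ ⋃ u ∈ (verts f).powersetCard 2, B u →
      1 - 6 * c ≤ (law V p).real (localEvent f T) := by
    intro B c hB hsub
    have h1 : (law V p).real (localEvent f T)ᶜ ≤ 6 * c := by
      refine (measureReal_mono hsub (measure_ne_top _ _)).trans ((measureReal_biUnion_finset_le _ _).trans ?_)
      rw [Finset.sum_congr rfl hB, Finset.sum_const, hcard]
      simp
    rw [probReal_compl_eq_one_sub .of_discrete] at h1
    linarith
  have h0' : T.card ≠ 0 := by simpa using h0
  unfold defect
  split_ifs with h1 h2
  · refine key (fun u => {G | ↑({u ∪ T} : Finset (Finset V)) ⊆ G}) _ (fun u hu => ?_) ?_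
    · rw [Finset.mem_powersetCard] at hu
      rw [setBernoulli_superset]
      · simp
      · simp only [Finset.coe_singleton, Set.singleton_subset_iff, Set.mem_ofPred_eq]
        rw [Finset.card_union_of_disjoint (hT.symm.mono_left hu.1), hu.2, h1]
    · intro G hG
      simp only [localEvent, h1] at hG
      simpa [and_assoc] using hG
  · refine key (fun u => {G | ↑(u.image fun a => insert a T) ⊆ G}) _ (fun u hu => ?_) ?_
    · rw [Finset.mem_powersetCard] at hu
      have hn : ∀ a ∈ u, a ∉ T := fun a ha haT => Finset.disjoint_left.1 hT haT (hu.1 ha)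
      rw [setBernoulli_superset, Finset.card_image_of_injOn, hu.2]
      · intro a ha b hb hab
        have : a ∈ insert b T := (show insert a T = insert b T from hab) ▸
          Finset.mem_insert_self a T
        exact (Finset.mem_insert.1 this).resolve_right (hn a ha)
      · intro e he
        simp only [Finset.coe_image, Set.mem_image] at he
        obtain ⟨a, ha, rfl⟩ := he
        simp only [Set.mem_ofPred_eq]
        rw [Finset.card_insert_of_notMem (hn a ha), h2]
    · intro G hG
      simp only [localEvent, h2] at hG
      simp only [Set.mem_iUnion]
      simpa [Set.subset_def, and_assoc] using hG
  · have : localEvent f T = Set.univ := by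
      ext G; simp [localEvent, h0, h1, h2]
    simp [this]

/-- Only singletons and pairs count, and those meeting `W` number at most `|W|` and `|W| |V|`. With
`W` everything this bounds the total cost of isolation; with `W` another copy's vertex set, the cost
of the conditions that interfere with that copy. -/
lemma sum_defect_le (J : Finset (Finset V)) (W : Finset V) (hJ : ∀ T ∈ J, T ≠ ∅ → ¬ Disjoint T W) :
    ∑ T ∈ J, defect p T ≤ W.card * (6 * p) + W.card * Fintype.card V * (6 * (p : ℝ) ^ 2) := by
  have hp := p.2.1
  have hsplit : ∀ T : Finset V, defect p T =
      (if T.card = 1 then 6 * (p : ℝ) else 0) + if T.card = 2 then 6 * (p : ℝ) ^ 2 else 0 := by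
    intro T
    unfold defect
    split_ifs <;> simp_all
  have h1 : (J.filter fun T => T.card = 1).card ≤ W.card := by
    refine (Finset.card_le_card (t := W.image fun x => {x}) fun T hT => ?_).trans
      Finset.card_image_le
    rw [Finset.mem_filter] at hT
    obtain ⟨x, rfl⟩ := Finset.card_eq_one.1 hT.2
    exact Finset.mem_image.2 ⟨x, by simpa using hJ _ hT.1 (by simp), rfl⟩
  have h2 : (J.filter fun T => T.card = 2).card ≤ W.card * Fintype.card V := by
    rw [← Finset.card_univ, ← Finset.card_product]
    refine (Finset.card_le_card (t := (W ×ˢ Finset.univ).image fun x => {x.1, x.2})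
      fun T hT => ?_).trans Finset.card_image_le
    rw [Finset.mem_filter] at hT
    obtain ⟨x, y, hxy, rfl⟩ := Finset.card_eq_two.1 hT.2
    have := hJ _ hT.1 (by simp)
    simp only [Finset.disjoint_insert_left, Finset.disjoint_singleton_left, not_and_or,
      not_not] at this
    obtain h | h := this
    · exact Finset.mem_image.2 ⟨(x, y), by simpa using h, rfl⟩
    · exact Finset.mem_image.2 ⟨(y, x), by simpa using h, Finset.pair_comm _ _⟩
  simp only [hsplit, Finset.sum_add_distrib, Finset.sum_ite, Finset.sum_const_zero, add_zero,
    Finset.sum_const, nsmul_eq_mul]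
  have h1' : ((J.filter fun T => T.card = 1).card : ℝ) ≤ W.card := by exact_mod_cast h1
  have h2' : ((J.filter fun T => T.card = 2).card : ℝ) ≤ W.card * Fintype.card V := by
    exact_mod_cast h2
  gcongr

/-- An edge has only one trace outside `verts f`, so the local events for different `T` depend on
disjoint sets of edges. -/
lemma measure_biInter_localEvent (f : Fin 4 ↪ V) {J : Finset (Finset V)}
    (hJ : ∀ T ∈ J, Disjoint T (verts f)) :
    (law V p).real (⋂ T ∈ J, localEvent f T) = ∏ T ∈ J, (law V p).real (localEvent f T) :=
  DeterminedBy.measure_biInter (fun T hT => determinedBy_localEvent (hJ T hT))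
    fun _ _ h => Set.disjoint_left.2 fun _ hS hT => h (hS.2.symm.trans hT.2)

lemma le_measure_isolated (hp : (p : ℝ) ≤ 1 / 12) (f : Fin 4 ↪ V) :
    (p : ℝ) ^ 3 * Real.exp (-(12 * (Fintype.card V * p) + 12 * (Fintype.card V * p) ^ 2)) ≤
      (law V p).real (isolated f) := by
  have hp0 := p.2.1
  have hJ : ∀ T ∈ (verts f)ᶜ.powerset, Disjoint T (verts f) := fun T hT => by
    simpa [Finset.subset_compl_iff_disjoint_right] using hT
  rw [isolated, measure_biInter_localEvent p f hJ,
    ← Finset.mul_prod_erase _ _ (Finset.empty_mem_powerset _), measure_localEvent_empty]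
  gcongr
  -- For `0 ≤ d ≤ 1/2` one has `(1 + 2d)(1 - d) ≥ 1`, hence `exp(2d) ≥ 1/(1 - d)`. The hypothesis `p
  -- ≤ 1/12` ensures `d ≤ 6p ≤ 1/2`.
  have hexp : ∀ T : Finset V, Real.exp (-2 * defect p T) ≤ 1 - defect p T := by
    intro T
    have h0 := defect_nonneg p T
    have h1 : defect p T ≤ 1 / 2 := (defect_le p T).trans (by linarith)
    have h2 := Real.add_one_le_exp (2 * defect p T)
    rw [neg_mul, Real.exp_neg, inv_le_comm₀ (Real.exp_pos _) (by linarith)]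
    refine le_trans ?_ h2
    rw [inv_le_iff_one_le_mul₀ (by linarith)]
    nlinarith
  calc _ ≤ Real.exp (∑ T ∈ (verts f)ᶜ.powerset.erase ∅, -2 * defect p T) := by
        rw [Real.exp_le_exp, ← Finset.mul_sum]
        have := sum_defect_le p ((verts f)ᶜ.powerset.erase ∅) Finset.univ
          fun T _ h => by simpa [Finset.disjoint_left, Finset.eq_empty_iff_forall_notMem] using h
        rw [Finset.card_univ] at this
        nlinarith
    _ = ∏ T ∈ (verts f)ᶜ.powerset.erase ∅, Real.exp (-2 * defect p T) := Real.exp_sum _ _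
    _ ≤ _ := Finset.prod_le_prod (fun _ _ => (Real.exp_pos _).le) fun T hT =>
      (hexp T).trans (one_sub_defect_le p f (hJ T (Finset.mem_of_mem_erase hT))
        (Finset.ne_of_mem_erase hT))

/-- The part of the isolation of `copyK4 f` that concerns edges disjoint from `W`. -/
def isolatedAway (f : Fin 4 ↪ V) (W : Finset V) : Set (HGraph V) :=
  ⋂ T ∈ (verts f)ᶜ.powerset.filter (Disjoint W), localEvent f T

lemma isolated_subset_isolatedAway (f : Fin 4 ↪ V) (W : Finset V) :
    isolated f ⊆ isolatedAway f W :=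
  Set.biInter_subset_biInter_left fun _ hT => Finset.mem_of_mem_filter _ hT

/-- The omitted conditions, those with `T` meeting `W`, are independent of the kept ones and all
hold except with probability `O(p + np²)`; so omitting them hardly changes the probability. -/
lemma measure_isolatedAway_mul_le {f : Fin 4 ↪ V} {W : Finset V} (hW : W.card = 4) :
    (law V p).real (isolatedAway f W) * (1 - 24 * p - 24 * Fintype.card V * (p : ℝ) ^ 2) ≤
      (law V p).real (isolated f) := by
  have hJ : ∀ T ∈ (verts f)ᶜ.powerset, Disjoint T (verts f) := fun T hT => by
    simpa [Finset.subset_compl_iff_disjoint_right] using hT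
  have hJ' : ∀ T ∈ (verts f)ᶜ.powerset.filter (¬ Disjoint W ·), Disjoint T (verts f) :=
    fun T hT => hJ T (Finset.mem_of_mem_filter _ hT)
  rw [isolated, measure_biInter_localEvent p f hJ,
    ← Finset.prod_filter_mul_prod_filter_not _ (Disjoint W), isolatedAway,
    measure_biInter_localEvent p f fun T hT => hJ T (Finset.mem_of_mem_filter _ hT),
    ← measure_biInter_localEvent p f hJ']
  gcongr
  have h1 : (law V p).real (⋂ T ∈ (verts f)ᶜ.powerset.filter (¬ Disjoint W ·), localEvent f T)ᶜ ≤
      ∑ T ∈ (verts f)ᶜ.powerset.filter (¬ Disjoint W ·), defect p T := by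
    simp only [Set.compl_iInter]
    refine (measureReal_biUnion_finset_le _ _).trans (Finset.sum_le_sum fun T hT => ?_)
    rw [probReal_compl_eq_one_sub .of_discrete]
    have := one_sub_defect_le p f (hJ' T hT) (by
      rintro rfl
      simp at hT)
    linarith
  rw [probReal_compl_eq_one_sub .of_discrete] at h1
  have h2 := sum_defect_le p ((verts f)ᶜ.powerset.filter (¬ Disjoint W ·)) W fun T hT _ h =>
    (Finset.mem_filter.1 hT).2 h.symm
  rw [hW] at h2
  push_cast at h2
  linarith

/-- After the conditions on edges meeting both vertex sets are dropped, the two events depend on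
disjoint sets of edges and are independent. -/
lemma measure_isolated_inter_of_disjoint {f g : Fin 4 ↪ V} (h : Disjoint (verts f) (verts g)) :
    (law V p).real (isolated f ∩ isolated g) ≤
      (law V p).real (isolatedAway f (verts g)) * (law V p).real (isolatedAway g (verts f)) := by
  have hdet : ∀ (f : Fin 4 ↪ V) (W : Finset V), Disjoint W (verts f) →
      DeterminedBy {e | ¬ Disjoint e (verts f) ∧ Disjoint e W} (isolatedAway f W) := by
    intro f W hW
    refine (DeterminedBy.biInter fun T hT => determinedBy_localEvent (f := f) (T := T) ?_).mono ?_
    · simpa [Finset.subset_compl_iff_disjoint_right] using Finset.mem_of_mem_filter _ hT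
    · intro e he
      simp only [Set.mem_iUnion] at he
      obtain ⟨T, hT, h1, h2⟩ := he
      refine ⟨h1, ?_⟩
      have h3 := (Finset.mem_filter.1 hT).2
      rw [← h2] at h3
      rw [Finset.disjoint_left] at *
      intro x hx hxW
      exact h3 hxW (Finset.mem_sdiff.2 ⟨hx, hW hxW⟩)
  rw [← (hdet f (verts g) h.symm).measure_inter (hdet g (verts f) h)
    (Set.disjoint_left.2 fun e he he' => he.1 he'.2)]
  exact measureReal_mono (Set.inter_subset_inter (isolated_subset_isolatedAway _ _)
    (isolated_subset_isolatedAway _ _))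

lemma measure_isolated_inter_of_disjoint_copyK4 {f g : Fin 4 ↪ V}
    (h : Disjoint (copyK4 f) (copyK4 g)) :
    (law V p).real (isolated f ∩ isolated g) ≤ (p : ℝ) ^ 6 := by
  have hc : (copyK4 f ∪ copyK4 g).card = 6 := by
    rw [Finset.card_union_of_disjoint h, card_copyK4, card_copyK4]
  rw [← hc, ← setBernoulli_superset p (u := {e : Finset V | e.card = 3})]
  · refine measureReal_mono fun G hG => ?_
    simp only [Set.mem_ofPred_eq, Finset.coe_union, Set.union_subset_iff]
    exact ⟨copyK4_subset_of_mem_isolated hG.1, copyK4_subset_of_mem_isolated hG.2⟩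
  · intro e he
    rw [Finset.mem_coe, Finset.mem_union] at he
    exact he.elim card_of_mem_copyK4 card_of_mem_copyK4

lemma isolated_inter_of_not_disjoint {f g : Fin 4 ↪ V} (hne : verts g ≠ verts f)
    (h : ¬ Disjoint (copyK4 f) (copyK4 g)) : isolated f ∩ isolated g = ∅ := by
  obtain ⟨e, hf, hg⟩ := Finset.not_disjoint_iff.1 h
  have hc := card_of_mem_copyK4 hf
  have hf' := subset_verts_of_mem_copyK4 hf
  obtain ⟨a, -, rfl⟩ := mem_copyK4.1 hg
  rw [Finset.card_map] at hc
  obtain ⟨i, hi, j, hj, hij⟩ := Finset.one_lt_card.1 (show 1 < a.card by omega)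
  exact isolated_inter_eq_empty hne hij (hf' (Finset.mem_map_of_mem g hi))
    (hf' (Finset.mem_map_of_mem g hj))

/-- The three terms treat vertex-disjoint copies, intersecting copies without a common edge, and
copies on the same vertex set. Copies on different vertex sets with a common edge contribute
nothing. -/
lemma measure_isolated_inter_le {δ : ℝ} (hδ : 0 < δ)
    (hδp : δ ≤ 1 - 24 * p - 24 * Fintype.card V * (p : ℝ) ^ 2) (f g : Fin 4 ↪ V) :
    (law V p).real (isolated f ∩ isolated g) ≤
      (law V p).real (isolated f) * (law V p).real (isolated g) / δ ^ 2 +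
        (if ¬ Disjoint (verts f) (verts g) then (p : ℝ) ^ 6 else 0) +
        if verts g = verts f then (law V p).real (isolated f) else 0 := by
  have hp := p.2.1
  have h1 : 0 ≤ (law V p).real (isolated f) * (law V p).real (isolated g) / δ ^ 2 := by positivity
  have h2 : 0 ≤ if ¬ Disjoint (verts f) (verts g) then (p : ℝ) ^ 6 else 0 := by
    split_ifs <;> positivity
  have h3 : 0 ≤ if verts g = verts f then (law V p).real (isolated f) else 0 := by
    split_ifs <;> positivity
  by_cases hd : Disjoint (verts f) (verts g)
  · have key : ∀ f g : Fin 4 ↪ V, (law V p).real (isolatedAway f (verts g)) ≤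
        (law V p).real (isolated f) / δ := fun f g => by
      rw [le_div_iff₀ hδ]
      refine le_trans ?_ (measure_isolatedAway_mul_le p (card_verts g))
      gcongr
    have : (law V p).real (isolated f ∩ isolated g) ≤
        (law V p).real (isolated f) * (law V p).real (isolated g) / δ ^ 2 := by
      refine (measure_isolated_inter_of_disjoint p hd).trans ?_
      rw [sq, ← div_mul_div_comm]
      exact mul_le_mul (key f g) (key g f) (by positivity) (by positivity)
    linarith
  rw [if_pos hd] at h2 ⊢
  by_cases he : verts g = verts f
  · rw [if_pos he]
    have : (law V p).real (isolated f ∩ isolated g) ≤ (law V p).real (isolated f) :=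
      measureReal_mono Set.inter_subset_left
    linarith
  by_cases hK : Disjoint (copyK4 f) (copyK4 g)
  · linarith [measure_isolated_inter_of_disjoint_copyK4 p hK]
  · rw [isolated_inter_of_not_disjoint he hK]
    simp only [measureReal_empty]
    linarith

/-! ### Counting pairs of copies and summing the second moment -/

lemma card_filter_not_disjoint_verts_le (f : Fin 4 ↪ V) :
    (Finset.univ.filter fun g : Fin 4 ↪ V => ¬ Disjoint (verts f) (verts g)).card ≤
      16 * Fintype.card V ^ 3 := by
  have h : ∀ x : Fin 4 × Fin 4, (Finset.univ.filter fun g : Fin 4 ↪ V => g x.2 = f x.1).card ≤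
      Fintype.card V ^ 3 := by
    rintro ⟨i, j⟩
    have : Fintype.card V ^ 3 = (Finset.univ : Finset (Fin 3 → V)).card := by simp
    rw [this]
    refine Finset.card_le_card_of_injOn (fun g k => g (j.succAbove k)) (by simp) ?_
    intro g hg g' hg' h
    simp only [Finset.coe_filter, Finset.mem_univ, true_and, Set.mem_ofPred_eq] at hg hg'
    ext k
    rcases Fin.eq_self_or_eq_succAbove j k with rfl | ⟨l, rfl⟩
    · rw [hg, hg']
    · exact congrFun h l
  calc _ ≤ (Finset.univ.biUnion fun x : Fin 4 × Fin 4 =>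
        Finset.univ.filter fun g : Fin 4 ↪ V => g x.2 = f x.1).card := by
        refine Finset.card_le_card fun g hg => ?_
        obtain ⟨v, hf, hg⟩ := Finset.not_disjoint_iff.1 (Finset.mem_filter.1 hg).2
        obtain ⟨i, -, rfl⟩ := Finset.mem_map.1 hf
        obtain ⟨j, -, hj⟩ := Finset.mem_map.1 hg
        simp only [Finset.mem_biUnion, Finset.mem_filter, Finset.mem_univ, true_and]
        exact ⟨(i, j), hj⟩
    _ ≤ 16 * Fintype.card V ^ 3 := by
        refine (Finset.card_biUnion_le_card_mul _ _ _ fun x _ => h x).trans ?_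
        simp

lemma card_filter_verts_eq_le (f : Fin 4 ↪ V) :
    (Finset.univ.filter fun g : Fin 4 ↪ V => verts g = verts f).card ≤ 256 := by
  have : 256 = (Fintype.piFinset fun _ : Fin 4 => verts f).card := by
    simp [card_verts]
  rw [this]
  refine Finset.card_le_card_of_injOn (fun g => g) (fun g hg => ?_) (DFunLike.coe_injective.injOn)
  simp only [Finset.coe_filter, Finset.mem_univ, true_and, Set.mem_ofPred_eq] at hg
  simp only [Finset.mem_coe, Fintype.mem_piFinset, ← hg]
  simp [verts]

lemma sum_measure_isolated_inter_le {δ : ℝ} (hδ : 0 < δ)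
    (hδp : δ ≤ 1 - 24 * p - 24 * Fintype.card V * (p : ℝ) ^ 2) :
    ∑ f : Fin 4 ↪ V, ∑ g : Fin 4 ↪ V, (law V p).real (isolated f ∩ isolated g) ≤
      (∑ f : Fin 4 ↪ V, (law V p).real (isolated f)) ^ 2 / δ ^ 2 +
        16 * Fintype.card V ^ 7 * (p : ℝ) ^ 6 +
        256 * ∑ f : Fin 4 ↪ V, (law V p).real (isolated f) := by
  have hp := p.2.1
  calc _ ≤ ∑ f : Fin 4 ↪ V, ∑ g : Fin 4 ↪ V, _ := Finset.sum_le_sum fun f _ =>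
        Finset.sum_le_sum fun g _ => measure_isolated_inter_le p hδ hδp f g
    _ = (∑ f : Fin 4 ↪ V, (law V p).real (isolated f)) ^ 2 / δ ^ 2 +
        ∑ f : Fin 4 ↪ V, ((Finset.univ.filter fun g : Fin 4 ↪ V =>
          ¬ Disjoint (verts f) (verts g)).card : ℝ) * (p : ℝ) ^ 6 +
        ∑ f : Fin 4 ↪ V, ((Finset.univ.filter fun g : Fin 4 ↪ V => verts g = verts f).card : ℝ) *
          (law V p).real (isolated f) := by
      simp only [Finset.sum_add_distrib, sq (∑ f : Fin 4 ↪ V, (law V p).real (isolated f)),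
        Finset.sum_mul_sum, Finset.sum_div]
      congr 2
      · refine Finset.sum_congr rfl fun f _ => ?_
        rw [← Finset.sum_filter, Finset.sum_const, nsmul_eq_mul]
      · funext f
        rw [← Finset.sum_filter, Finset.sum_const, nsmul_eq_mul]
    _ ≤ _ := by
      rw [Finset.mul_sum]
      gcongr with f hf
      · calc _ ≤ ∑ f : Fin 4 ↪ V, (16 * (Fintype.card V : ℝ) ^ 3) * (p : ℝ) ^ 6 := by
              gcongr with f hf
              exact_mod_cast card_filter_not_disjoint_verts_le f
          _ = Fintype.card (Fin 4 ↪ V) * ((16 * (Fintype.card V : ℝ) ^ 3) * (p : ℝ) ^ 6) := by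
              simp
          _ ≤ (Fintype.card V : ℝ) ^ 4 * ((16 * (Fintype.card V : ℝ) ^ 3) * (p : ℝ) ^ 6) := by
              gcongr
              rw [Fintype.card_embedding_eq, Fintype.card_fin]
              exact_mod_cast Nat.descFactorial_le_pow _ _
          _ = _ := by ring
      · exact_mod_cast card_filter_verts_eq_le f

end HGraph

/-! ### Asymptotics for `p = 0.1 √(log n) / n` -/

namespace HGraph

open ProbabilityTheory

lemma measure_compl_iUnion_isolated_le {V : Type*} [Fintype V] [DecidableEq V] (p : unitInterval)
    {δ Y : ℝ} (hδ : 0 < δ) (hδp : δ ≤ 1 - 24 * p - 24 * Fintype.card V * (p : ℝ) ^ 2) (hY : 0 < Y)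
    (hYp : Y ≤ ∑ f : Fin 4 ↪ V, (law V p).real (isolated f)) :
    (law V p).real (⋃ f : Fin 4 ↪ V, isolated f)ᶜ ≤
      1 / δ ^ 2 + 16 * Fintype.card V ^ 7 * (p : ℝ) ^ 6 / Y ^ 2 + 256 / Y - 1 := by
  have hp := p.2.1
  have h := measure_compl_iUnion_le (law V p) Finset.univ (A := fun f : Fin 4 ↪ V => isolated f)
    (fun _ => .of_discrete) (hY.trans_le hYp)
  simp only [Finset.mem_univ, Set.iUnion_true] at h
  have hsum := sum_measure_isolated_inter_le (V := V) p hδ hδp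
  set Z := ∑ f : Fin 4 ↪ V, (law V p).real (isolated f) with hZ
  have hZ0 : 0 < Z := hY.trans_le hYp
  refine h.trans ?_
  gcongr
  calc _ ≤ (Z ^ 2 / δ ^ 2 + 16 * Fintype.card V ^ 7 * (p : ℝ) ^ 6 + 256 * Z) / Z ^ 2 := by gcongr
    _ = 1 / δ ^ 2 + 16 * Fintype.card V ^ 7 * (p : ℝ) ^ 6 / Z ^ 2 + 256 / Z := by field_simp
    _ ≤ _ := by gcongr

/-- The expected number of triples containing two given vertices, up to lower order terms. -/
lemma natCast_mul_edgeProb (n : ℕ) : n * (edgeProb n : ℝ) = 0.1 * √(Real.log n) := by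
  rcases Nat.eq_zero_or_pos n with rfl | hn
  · simp
  · have : (n : ℝ) ≠ 0 := by positivity
    simp only [edgeProb]
    field_simp

lemma eventually_log_ge (C : ℝ) : ∀ᶠ n : ℕ in atTop, C ≤ Real.log n :=
  (Real.tendsto_log_atTop.comp tendsto_natCast_atTop_atTop).eventually_ge_atTop C

lemma tendsto_log_div : Tendsto (fun n : ℕ => Real.log n / n) atTop (𝓝 0) :=
  (Real.isLittleO_log_id_atTop.tendsto_div_nhds_zero).comp tendsto_natCast_atTop_atTop

lemma eventually_measure_compl_le :
    ∀ᶠ n : ℕ in atTop,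
      (law (Fin n) (edgeProb n)).real (⋃ f : Fin 4 ↪ Fin n, isolated f)ᶜ ≤
        1 / (1 - Real.log n / n) ^ 2 + 4096 * (n : ℝ) ^ (-(1 / 2) : ℝ) +
          4096 * (n : ℝ) ^ (-(3 / 4) : ℝ) - 1 := by
  filter_upwards [eventually_log_ge 10000, eventually_ge_atTop 6,
    tendsto_log_div.eventually_le_const (show (0 : ℝ) < 1 / 2 by norm_num)] with n hlog hn hle
  have hx := natCast_mul_edgeProb n
  have hp0 : 0 ≤ (edgeProb n : ℝ) := (edgeProb n).2.1
  generalize edgeProb n = p at *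
  have hs2 : √(Real.log n) ^ 2 = Real.log n := Real.sq_sqrt (by linarith)
  have hs : 100 ≤ √(Real.log n) := Real.le_sqrt_of_sq_le (by linarith)
  set l := Real.log n with hl
  set s := √l with hsdef
  have hn0 : (0 : ℝ) < n := by positivity
  have hn6 : (6 : ℝ) ≤ n := by exact_mod_cast hn
  have hnp : 1 ≤ n * (p : ℝ) := by rw [hx]; linarith
  have hnp2 : (n * (p : ℝ)) ^ 2 = 0.01 * l := by rw [hx, mul_pow, hs2]; norm_num
  have hnp1 : n * (p : ℝ) ≤ 0.001 * l := by rw [hx]; nlinarith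
  have hpl : (p : ℝ) ≤ 0.001 * (l / n) := by
    rw [← mul_div_assoc, le_div_iff₀ hn0]
    linarith
  have hpl2 : n * (p : ℝ) ^ 2 ≤ 0.01 * (l / n) := by
    rw [← mul_div_assoc, le_div_iff₀ hn0]
    linarith
  have hp : (0 : ℝ) < p := by
    by_contra! h
    nlinarith
  -- As `√(log n) ≥ 100`, the exponent is at most `0.012 log n + 0.12 log n`, below `(log n) / 4`.
  -- The small constant `0.1` is what makes this work.
  have hE : (n : ℝ) ^ (-(1 / 4) : ℝ) ≤
      Real.exp (-(12 * (Fintype.card (Fin n) * p) + 12 * (Fintype.card (Fin n) * p) ^ 2)) := by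
    rw [Real.rpow_def_of_pos hn0, Real.exp_le_exp, Fintype.card_fin, hnp2]
    linarith
  set L := (n : ℝ) ^ (-(1 / 4) : ℝ) with hL
  have hL0 : 0 < L := by positivity
  have hN : (n : ℝ) ^ 4 / 16 ≤ Fintype.card (Fin 4 ↪ Fin n) := by
    have h1 := Nat.pow_sub_le_descFactorial n 4
    rw [Fintype.card_embedding_eq, Fintype.card_fin, Fintype.card_fin]
    have h2 : (((n + 1 - 4) ^ 4 : ℕ) : ℝ) ≤ (n.descFactorial 4 : ℕ) := by exact_mod_cast h1
    refine le_trans ?_ h2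
    have h3 : ((n + 1 - 4 : ℕ) : ℝ) = n - 3 := by
      rw [show n + 1 - 4 = n - 3 by omega, Nat.cast_sub (by omega)]
      norm_num
    rw [Nat.cast_pow, h3, show (n : ℝ) ^ 4 / 16 = (n / 2) ^ 4 by ring]
    gcongr
    linarith
  have hY : (n : ℝ) ^ 4 / 16 * ((p : ℝ) ^ 3 * L) ≤
      ∑ f : Fin 4 ↪ Fin n, (law (Fin n) p).real (isolated f) := by
    calc _ ≤ (Fintype.card (Fin 4 ↪ Fin n) : ℝ) * ((p : ℝ) ^ 3 * L) := by gcongr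
      _ = ∑ f : Fin 4 ↪ Fin n, (p : ℝ) ^ 3 * L := by simp
      _ ≤ _ := Finset.sum_le_sum fun f _ => le_trans (by gcongr)
        (le_measure_isolated p (by linarith) f)
  -- This `δ` is admissible because `24p + 24np² ≤ 0.264 (log n) / n`.
  refine (measure_compl_iUnion_isolated_le p (δ := 1 - l / n) (by linarith)
    (by rw [Fintype.card_fin]; nlinarith) (by positivity) hY).trans ?_
  rw [Fintype.card_fin]
  have hL2 : (n : ℝ) ^ (-(1 / 2) : ℝ) = 1 / (n * L ^ 2) := by
    rw [hL, ← Real.rpow_natCast, ← Real.rpow_mul hn0.le, ← Real.rpow_one_add' hn0.le (by norm_num),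
      one_div (_ ^ _), ← Real.rpow_neg hn0.le]
    norm_num
  have hL3 : (n : ℝ) ^ (-(3 / 4) : ℝ) = 1 / (n * L) := by
    rw [hL, ← Real.rpow_one_add' hn0.le (by norm_num), one_div (_ ^ _),
      ← Real.rpow_neg hn0.le]
    norm_num
  have e1 : 16 * (n : ℝ) ^ 7 * (p : ℝ) ^ 6 / ((n : ℝ) ^ 4 / 16 * ((p : ℝ) ^ 3 * L)) ^ 2 =
      4096 * (n : ℝ) ^ (-(1 / 2) : ℝ) := by
    rw [hL2]
    field_simp
    norm_num
  have e2 : 256 / ((n : ℝ) ^ 4 / 16 * ((p : ℝ) ^ 3 * L)) ≤ 4096 * (n : ℝ) ^ (-(3 / 4) : ℝ) := by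
    rw [hL3, show (n : ℝ) ^ 4 / 16 * ((p : ℝ) ^ 3 * L) = (n * p) ^ 3 * (n * L) / 16 by ring,
      mul_one_div, div_le_div_iff₀ (by positivity) (by positivity)]
    nlinarith [one_le_pow₀ hnp (n := 3), mul_pos hn0 hL0]
  rw [e1]
  linarith

lemma whp_exists_isolated :
    Whp (fun n => randomHGraph 3 n (edgeProb n)) fun _ G => ∃ f, G ∈ isolated f := by
  -- The `2` is `1`, from passing to the complement, plus the `1` subtracted in the second moment
  -- bound.
  have hr : Tendsto (fun n : ℕ => 2 - (1 / (1 - Real.log n / n) ^ 2 +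
      4096 * (n : ℝ) ^ (-(1 / 2) : ℝ) + 4096 * (n : ℝ) ^ (-(3 / 4) : ℝ))) atTop (𝓝 1) := by
    have h1 : Tendsto (fun n : ℕ => (n : ℝ) ^ (-(1 / 2) : ℝ)) atTop (𝓝 0) :=
      (tendsto_rpow_neg_atTop (by norm_num)).comp tendsto_natCast_atTop_atTop
    have h2 : Tendsto (fun n : ℕ => (n : ℝ) ^ (-(3 / 4) : ℝ)) atTop (𝓝 0) :=
      (tendsto_rpow_neg_atTop (by norm_num)).comp tendsto_natCast_atTop_atTop
    have h3 := ((tendsto_log_div.const_sub 1).pow 2).inv₀ (by norm_num)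
    have := ((h3.add (h1.const_mul 4096)).add (h2.const_mul 4096)).const_sub 2
    simp only [one_div] at this ⊢
    rwa [show (2 : ℝ) - (((1 - 0) ^ 2)⁻¹ + 4096 * 0 + 4096 * 0) = 1 by norm_num] at this
  have hreal : Tendsto (fun n : ℕ => (law (Fin n) (edgeProb n)).real {G | ∃ f, G ∈ isolated f})
      atTop (𝓝 1) := by
    refine tendsto_of_tendsto_of_tendsto_of_le_of_le' hr tendsto_const_nhds ?_
      (.of_forall fun _ => measureReal_le_one)
    filter_upwards [eventually_measure_compl_le] with n hn
    rw [probReal_compl_eq_one_sub .of_discrete] at hn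
    have : {G : HGraph (Fin n) | ∃ f, G ∈ isolated f} = ⋃ f : Fin 4 ↪ Fin n, isolated f := by
      ext; simp
    rw [this]
    linarith
  have h := ENNReal.tendsto_ofReal hreal
  rw [ENNReal.ofReal_one] at h
  exact h.congr fun n => ofReal_measureReal (measure_ne_top (law (Fin n) (edgeProb n)) _)

lemma Whp.mono {Ω : ℕ → Type*} [∀ n, MeasurableSpace (Ω n)] {P : ∀ n, Measure (Ω n)}
    [∀ n, IsProbabilityMeasure (P n)] {A B : ∀ n, Ω n → Prop} (hA : Whp P A)
    (h : ∀ n ω, A n ω → B n ω) : Whp P B :=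
  tendsto_of_tendsto_of_tendsto_of_le_of_le hA tendsto_const_nhds
    (fun n => measure_mono (h n)) fun _ => prob_le_one

end HGraph

theorem mainTheorem2 :
    Whp (fun n => randomHGraph 3 n (edgeProb n)) (fun n G =>
      ∃ K : HGraph (Fin n), HGraph.IsCopy HGraph.K4minus K ∧ K ⊆ G ∧
        ∀ e ∈ K, ∀ C : HGraph (Fin n), HGraph.IsCopy HGraph.F5 C → C ⊆ G → e ∉ C) ∧
    Whp (fun n => randomHGraph 3 n (edgeProb n)) (fun n G =>
      ∃ M : HGraph (Fin n), HGraph.IsMaximumFreeSub HGraph.F5 M G ∧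
        ¬ HGraph.IsTripartite M) := by
  have : ∀ n, IsProbabilityMeasure (randomHGraph 3 n (edgeProb n)) := fun n => by
    unfold randomHGraph; infer_instance
  constructor
  · refine HGraph.Whp.mono HGraph.whp_exists_isolated fun n G => ?_
    rintro ⟨f, hf⟩
    exact ⟨_, HGraph.isCopy_copyK4 f, HGraph.copyK4_subset_of_mem_isolated hf,
      HGraph.isolated_notMem_F5 hf⟩
  · refine HGraph.Whp.mono HGraph.whp_exists_isolated fun n G => ?_
    rintro ⟨f, hf⟩
    exact HGraph.exists_max_not_isTripartite (HGraph.isCopy_copyK4 f)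
      (HGraph.copyK4_subset_of_mem_isolated hf) (HGraph.isolated_notMem_F5 hf)
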